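/- **Conventions.** All objects below are indexed by $\theta$ in an arbitrary index set $\Theta$ (the index is usually omitted). For real families, $a\le O(b)$ (resp. $a\ge O(b)$) means that there is a constant $C>0$, independent of $\theta$, with $a_\theta\le C b_\theta$ (resp. $a_\theta\ge C b_\theta$) for all $\theta$. For random vectors $Z_\theta$ in normed spaces $E_\theta$, $q>0$ and $\sigma_\theta>0$, we write $Z\propto\mathcal E_q(\sigma)$ if there are constants $C,c>0$ such that for all $\theta$, all $1$-Lipschitz $f:E_\theta\to\mathbb R$ and all $t>0$, $$\mathbb P\big(|f(Z_\theta)-f(Z_\theta')|\ge t\big)\le C e^{-(t/(c\sigma_\theta))^q},$$ where $Z'_\theta$ is an independent copy of $Z_\theta$; $\mathcal E_q$ stands for $\mathcal E_q(1)$. On vectors $\|\cdot\|$ is the Euclidean norm, on matrices it is the spectral norm, and $\|\cdot\|_F$ is the Frobenius norm. For a matrix $M$ with $n$ columns, $M_{-i}$ is $M$ with its $i$-th column replaced by $0$. **Proposition.** Let $n\ge 2$ and $p\le O(n)$, let $X=(x_1,\dots,x_n)$ and $Y=(y_1,\dots,y_n)$ be random $p\times n$ real matrices and $D$ a random diagonal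 $n\times n$ real matrix. Assume: - $(X,D,Y)\propto\mathcal E_2$ for the norm $\max(\|X\|_F,\|D\|_F,\|Y\|_F)$; - the couples $(x_i,y_i)$, $1\le i\le n$, are independent; - $O(1)\le \sup_{i}\|\mathbb E[x_i]\|\le O(1)$ and $O(1)\le\sup_{i}\|\mathbb E[y_i]\|\le O(1)$; - for every $i$ there is a random diagonal matrix $D^{(i)}$ such that $(D^{(i)},X_{-i},Y_{-i})$ is independent of $(x_i,y_i)$, and almost surely $\sup_{i}\|D_{-i}-D^{(i)}_{-i}\|_F\le O(1)$; - there are $\kappa,\kappa_D,\varepsilon>0$ (possibly depending on $\theta$) with $\kappa,\kappa_D\le O(1)$, $\varepsilon\ge O(1)$, such that almost surely $\|X\|,\|Y\|\le\sqrt n\,\kappa$ and $\|D\|\le\kappa_D$, and $\kappa^2\kappa_D\le 1-\varepsilon$. Then $I_p-\frac1n XDY^T$ is almost surely invertible and, with $Q=(I_p-\frac1n XDY^T)^{-1}$, for all deterministic vectors $u\in\mathbb R^p$ with $\|u\|\le O(1)$, $$Qu\propto\mathcal E_1\Big(\sqrt{\tfrac{\log n}{n}}\Big)\quad\text{in }(\mathbb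 R^p,\|\cdot\|).$$ -/

import Mathlib

open MeasureTheory ProbabilityTheory Matrix
open scoped Matrix.Norms.Frobenius

/-- Matrices carry the product (entrywise) `σ`-algebra, i.e. the Borel one in finite dimension. -/
instance matrixMeasurableSpace {m n : Type*} : MeasurableSpace (Matrix m n ℝ) :=
  inferInstanceAs (MeasurableSpace (m → n → ℝ))

/-- `a ≤ O(b)` over the whole index set: one constant `C > 0` with `a θ ≤ C * b θ` for all `θ`. -/
def LeO {Θ : Type*} (a b : Θ → ℝ) : Prop := ∃ C : ℝ, 0 < C ∧ ∀ θ, a θ ≤ C * b θ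

/-- `a ≥ O(b)` over the whole index set: one constant `C > 0` with `a θ ≥ C * b θ` for all `θ`. -/
def GeO {Θ : Type*} (a b : Θ → ℝ) : Prop := ∃ C : ℝ, 0 < C ∧ ∀ θ, C * b θ ≤ a θ

/-- `Z ∝ 𝓔_q(σ)`: Lipschitz `q`-exponential concentration with observable diameter `O(σ)` of a
family of random vectors `Z θ : Ω θ → E θ`. The constants `C, c` are uniform in the index `θ`, in
the `1`-Lipschitz observation `f` and in `t`. The product space `Ω θ × Ω θ` carries `Z θ` and an
independent copy of it. -/
def LipschitzConcentrated {Θ : Type*} {Ω : Θ → Type*} [∀ θ, MeasurableSpace (Ω θ)]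
    (P : ∀ θ, Measure (Ω θ)) {E : Θ → Type*} [∀ θ, SeminormedAddCommGroup (E θ)]
    (Z : ∀ θ, Ω θ → E θ) (q : ℝ) (σ : Θ → ℝ) : Prop :=
  ∃ C c : ℝ, 0 < C ∧ 0 < c ∧ ∀ θ, ∀ f : E θ → ℝ, LipschitzWith 1 f → ∀ t : ℝ, 0 < t →
    ((P θ).prod (P θ)).real {ω | t ≤ |f (Z θ ω.1) - f (Z θ ω.2)|} ≤
      C * Real.exp (-(t / (c * σ θ)) ^ q)

/-- The spectral norm of a matrix (operator norm between Euclidean spaces); the notation `‖M‖`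
on matrices is the Frobenius norm. -/
noncomputable def matSpectralNorm {m n : ℕ} (M : Matrix (Fin m) (Fin n) ℝ) : ℝ :=
  ‖LinearMap.toContinuousLinearMap (Matrix.toEuclideanLin M)‖

/-- The `i`-th column of a matrix as a vector of the Euclidean space. -/
noncomputable def colVec {m n : ℕ} (M : Matrix (Fin m) (Fin n) ℝ) (i : Fin n) :
    EuclideanSpace ℝ (Fin m) :=
  WithLp.toLp 2 (fun k => M k i)

/-- `M_{-i}`: the matrix `M` with its `i`-th column replaced by `0` (on a diagonal matrix this
replaces the `i`-th diagonal entry by `0`). -/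
def dropCol {m n : ℕ} (M : Matrix (Fin m) (Fin n) ℝ) (i : Fin n) : Matrix (Fin m) (Fin n) ℝ :=
  M.updateCol i 0

/-- The matrix `I_p - (1/n) X D Yᵀ`. -/
noncomputable def resolventDenom {p n : ℕ} (X : Matrix (Fin p) (Fin n) ℝ)
    (D : Matrix (Fin n) (Fin n) ℝ) (Y : Matrix (Fin p) (Fin n) ℝ) : Matrix (Fin p) (Fin p) ℝ :=
  1 - (1 / (n : ℝ)) • (X * D * Yᵀ)

/-- The resolvent `Q = (I_p - (1/n) X D Yᵀ)⁻¹`. -/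
noncomputable def resolventQ {p n : ℕ} (X : Matrix (Fin p) (Fin n) ℝ)
    (D : Matrix (Fin n) (Fin n) ℝ) (Y : Matrix (Fin p) (Fin n) ℝ) : Matrix (Fin p) (Fin p) ℝ :=
  (resolventDenom X D Y)⁻¹

/-!
The resolvent identity `Q - Q' = Q (M - M') Q'`, with `M = n⁻¹ X D Yᵀ`, shows that `Q u` varies by
`O(n^{-1/2})` with `X` and `Y`, since `‖Q‖ ≤ 1/ε` and `‖X‖, ‖Y‖ = O(√n)`. The increment in `D` alone
would only give a Lipschitz constant `O(1)`; but `D` is diagonal, so that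
`‖(D - D') Y'ᵀ Q' u‖ ≤ ‖D - D'‖_F sup_i |y'_iᵀ Q' u|`, and on the set where
`sup_i |y_iᵀ Q u| ≤ s` the Lipschitz constant is `O((1 + s) / √n)` (`norm_resolventQ_sub_le`). The
estimate holds between any two points of this set, so a Lipschitz extension of the restriction
transfers the concentration of `(X, D, Y)`, at the cost of the probability of the complement
(`concentration_of_lipschitz_on`).

The supremum is controlled by leaving one column out. Let `Q₁` be the resolvent of `X_{-i}`, `Y_{-i}`
and of `D^{(i)}`, truncated to `[-κD, κD]` so that `Q₁` is bounded by `1/ε` too. Then `y_iᵀ Q u` is at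
most `1/ε` times `|y_iᵀ Q₁ u| + O(n^{-1/2}) sup_j |y_iᵀ Q₁ x_j|` (`abs_inner_resolventQ_le`): the
rank-one term `D_i x_i y_iᵀ / n` only multiplies by a bounded factor, and in the term
`y_iᵀ Q₁ X_{-i} (D^{(i)} - D) Y_{-i}ᵀ Q₂ u / n`, where `Q₂` is the resolvent of `X_{-i}`, `D`,
`Y_{-i}`, the resolvent independent of `y_i` is put next to
`y_i`, which leaves a vector of norm `O(√n)` on the other side. As `y_i` is independent of `Q₁ u` and
of `Q₁ x_j`, whose norms are `O(1)` and `O(√n)`, its linear forms have Gaussian tails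
(`measureReal_abs_ge_le_of_symmetrized`), and a union bound gives
`P(sup_i |y_iᵀ Q u| ≥ B (t + T)) ≤ O(n²) exp(-t² / c²)` (`measureReal_sup_inner_resolventQ_le`).

Taking `t² = r √(n log n)` for a deviation `r` of `Q u` makes both the truncation probability and the
Gaussian tail at scale `(1 + t) / √n` of order `exp(-r √(n / log n) / c)`
(`le_exp_of_forall_truncation`).
-/

/-! ### Euclidean action of real matrices -/

section Euclidean

variable {m n k : ℕ}

theorem toEuclideanLin_mul_apply (A : Matrix (Fin m) (Fin n) ℝ) (B : Matrix (Fin n) (Fin k) ℝ)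
    (v : EuclideanSpace ℝ (Fin k)) :
    toEuclideanLin (A * B) v = toEuclideanLin A (toEuclideanLin B v) := by
  simp [Matrix.toLpLin_apply, Matrix.mulVec_mulVec]

theorem norm_toEuclideanLin_le (A : Matrix (Fin m) (Fin n) ℝ) (v : EuclideanSpace ℝ (Fin n)) :
    ‖toEuclideanLin A v‖ ≤ matSpectralNorm A * ‖v‖ :=
  (LinearMap.toContinuousLinearMap (toEuclideanLin A)).le_opNorm v

theorem norm_toEuclideanLin_le_of_le {A : Matrix (Fin m) (Fin n) ℝ}
    {v : EuclideanSpace ℝ (Fin n)} {a b : ℝ} (hA : matSpectralNorm A ≤ a) (hv : ‖v‖ ≤ b) :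
    ‖toEuclideanLin A v‖ ≤ a * b :=
  (norm_toEuclideanLin_le A v).trans
    (mul_le_mul hA hv (norm_nonneg _) ((norm_nonneg _).trans hA))

theorem matSpectralNorm_nonneg (A : Matrix (Fin m) (Fin n) ℝ) : 0 ≤ matSpectralNorm A :=
  norm_nonneg _

theorem matSpectralNorm_le {A : Matrix (Fin m) (Fin n) ℝ} {b : ℝ} (hb : 0 ≤ b)
    (h : ∀ v, ‖toEuclideanLin A v‖ ≤ b * ‖v‖) : matSpectralNorm A ≤ b :=
  ContinuousLinearMap.opNorm_le_bound _ hb h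

theorem inner_toEuclideanLin_transpose (A : Matrix (Fin m) (Fin n) ℝ)
    (v : EuclideanSpace ℝ (Fin m)) (w : EuclideanSpace ℝ (Fin n)) :
    inner ℝ (toEuclideanLin Aᵀ v) w = inner ℝ v (toEuclideanLin A w) := by
  rw [← Matrix.conjTranspose_eq_transpose_of_trivial,
    Matrix.toEuclideanLin_conjTranspose_eq_adjoint, LinearMap.adjoint_inner_left]

theorem matSpectralNorm_transpose_le (A : Matrix (Fin m) (Fin n) ℝ) :
    matSpectralNorm Aᵀ ≤ matSpectralNorm A := by
  refine matSpectralNorm_le (matSpectralNorm_nonneg A) fun v => ?_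
  by_cases h0 : ‖toEuclideanLin Aᵀ v‖ = 0
  · rw [h0]; exact mul_nonneg (matSpectralNorm_nonneg A) (norm_nonneg _)
  · have hpos : 0 < ‖toEuclideanLin Aᵀ v‖ := lt_of_le_of_ne (norm_nonneg _) (Ne.symm h0)
    have h1 : ‖toEuclideanLin Aᵀ v‖ * ‖toEuclideanLin Aᵀ v‖ ≤
        matSpectralNorm A * ‖v‖ * ‖toEuclideanLin Aᵀ v‖ := by
      rw [← real_inner_self_eq_norm_mul_norm, inner_toEuclideanLin_transpose]
      refine (real_inner_le_norm _ _).trans ?_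
      calc ‖v‖ * ‖toEuclideanLin A (toEuclideanLin Aᵀ v)‖
          ≤ ‖v‖ * (matSpectralNorm A * ‖toEuclideanLin Aᵀ v‖) := by
            gcongr; exact norm_toEuclideanLin_le _ _
        _ = _ := by ring
    exact le_of_mul_le_mul_right h1 hpos

theorem frobenius_norm_sq (A : Matrix (Fin m) (Fin n) ℝ) :
    ‖A‖ ^ 2 = ∑ i, ∑ j, A i j ^ 2 := by
  have h : (0 : ℝ) ≤ ∑ i, ∑ j, A i j ^ 2 :=
    Finset.sum_nonneg fun i _ => Finset.sum_nonneg fun j _ => sq_nonneg _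
  rw [Matrix.frobenius_norm_def, ← Real.sqrt_eq_rpow]
  simp [Real.sq_sqrt h]

theorem norm_toEuclideanLin_le_frobenius (A : Matrix (Fin m) (Fin n) ℝ)
    (v : EuclideanSpace ℝ (Fin n)) : ‖toEuclideanLin A v‖ ≤ ‖A‖ * ‖v‖ := by
  refine le_of_sq_le_sq ?_ (by positivity)
  rw [mul_pow, EuclideanSpace.real_norm_sq_eq, frobenius_norm_sq, EuclideanSpace.real_norm_sq_eq,
    Finset.sum_mul]
  refine Finset.sum_le_sum fun i _ => ?_
  simp only [Matrix.toLpLin_apply, Matrix.mulVec, dotProduct]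
  exact Finset.sum_mul_sq_le_sq_mul_sq _ _ _

theorem matSpectralNorm_le_frobenius (A : Matrix (Fin m) (Fin n) ℝ) : matSpectralNorm A ≤ ‖A‖ :=
  matSpectralNorm_le (norm_nonneg _) (norm_toEuclideanLin_le_frobenius A)

theorem toEuclideanLin_transpose_apply (A : Matrix (Fin m) (Fin n) ℝ)
    (v : EuclideanSpace ℝ (Fin m)) (i : Fin n) :
    toEuclideanLin Aᵀ v i = inner ℝ (colVec A i) v := by
  simp [Matrix.toLpLin_apply, Matrix.mulVec, dotProduct, colVec, PiLp.inner_apply, mul_comm]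

theorem colVec_eq (A : Matrix (Fin m) (Fin n) ℝ) (i : Fin n) :
    colVec A i = toEuclideanLin A (EuclideanSpace.single i 1) := by
  ext k
  simp [Matrix.toLpLin_apply, colVec]

theorem norm_colVec_le (A : Matrix (Fin m) (Fin n) ℝ) (i : Fin n) :
    ‖colVec A i‖ ≤ matSpectralNorm A := by
  rw [colVec_eq]
  simpa using norm_toEuclideanLin_le A (EuclideanSpace.single i 1)

theorem colVec_sub (A B : Matrix (Fin m) (Fin n) ℝ) (i : Fin n) :
    colVec (A - B) i = colVec A i - colVec B i := by
  ext k; simp [colVec]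

theorem abs_apply_le_matSpectralNorm (A : Matrix (Fin m) (Fin n) ℝ) (i : Fin m) (j : Fin n) :
    |A i j| ≤ matSpectralNorm A := by
  refine le_trans ?_ (norm_colVec_le A j)
  simpa [colVec] using PiLp.norm_apply_le (colVec A j) i

theorem Matrix.IsDiag.toEuclideanLin_apply {D : Matrix (Fin n) (Fin n) ℝ} (hD : D.IsDiag)
    (v : EuclideanSpace ℝ (Fin n)) (i : Fin n) : toEuclideanLin D v i = D i i * v i := by
  simp only [Matrix.toLpLin_apply, Matrix.mulVec, dotProduct]
  exact Finset.sum_eq_single i (fun j _ hj => by simp [hD (Ne.symm hj)]) (by simp)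

theorem Matrix.IsDiag.matSpectralNorm_le {D : Matrix (Fin n) (Fin n) ℝ} (hD : D.IsDiag) {b : ℝ}
    (hb : 0 ≤ b) (h : ∀ i, |D i i| ≤ b) : matSpectralNorm D ≤ b := by
  refine _root_.matSpectralNorm_le hb fun v => le_of_sq_le_sq ?_ (by positivity)
  rw [mul_pow, EuclideanSpace.real_norm_sq_eq, EuclideanSpace.real_norm_sq_eq, Finset.mul_sum]
  refine Finset.sum_le_sum fun i _ => ?_
  rw [hD.toEuclideanLin_apply, mul_pow]
  exact mul_le_mul_of_nonneg_right (sq_le_sq' (abs_le.1 (h i)).1 (abs_le.1 (h i)).2) (sq_nonneg _)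

/-- The Frobenius norm of a diagonal matrix is paired with the supremum of the coordinates of `v`,
in place of `‖v‖`: for the vectors `Yᵀ Q u` this gains a factor of order `√(n / log n)`. -/
theorem Matrix.IsDiag.norm_toEuclideanLin_le {D : Matrix (Fin n) (Fin n) ℝ} (hD : D.IsDiag)
    {v : EuclideanSpace ℝ (Fin n)} {s : ℝ} (hs : 0 ≤ s) (h : ∀ i, |v i| ≤ s) :
    ‖toEuclideanLin D v‖ ≤ ‖D‖ * s := by
  refine le_of_sq_le_sq ?_ (by positivity)
  rw [mul_pow, EuclideanSpace.real_norm_sq_eq, frobenius_norm_sq, Finset.sum_mul]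
  refine Finset.sum_le_sum fun i _ => ?_
  rw [hD.toEuclideanLin_apply, mul_pow]
  have h2 : v i ^ 2 ≤ s ^ 2 := sq_le_sq' (abs_le.1 (h i)).1 (abs_le.1 (h i)).2
  have h3 : D i i ^ 2 ≤ ∑ j, D i j ^ 2 :=
    Finset.single_le_sum (f := fun j => D i j ^ 2) (fun j _ => sq_nonneg _) (Finset.mem_univ i)
  gcongr

theorem dropCol_apply (A : Matrix (Fin m) (Fin n) ℝ) (i j : Fin n) (k : Fin m) :
    dropCol A i k j = if j = i then 0 else A k j := by
  simp [dropCol, Matrix.updateCol_apply]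

theorem matSpectralNorm_dropCol_le (A : Matrix (Fin m) (Fin n) ℝ) (i : Fin n) :
    matSpectralNorm (dropCol A i) ≤ matSpectralNorm A := by
  refine matSpectralNorm_le (matSpectralNorm_nonneg A) fun v => ?_
  have h : toEuclideanLin (dropCol A i) v =
      toEuclideanLin A (WithLp.toLp 2 fun j => if j = i then 0 else v j) := by
    ext k
    simp only [Matrix.toLpLin_apply, Matrix.mulVec, dotProduct, dropCol_apply]
    exact Finset.sum_congr rfl fun j _ => by split_ifs <;> simp
  rw [h]
  refine norm_toEuclideanLin_le_of_le le_rfl (le_of_sq_le_sq ?_ (norm_nonneg _))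
  rw [EuclideanSpace.real_norm_sq_eq, EuclideanSpace.real_norm_sq_eq]
  refine Finset.sum_le_sum fun j _ => ?_
  simp only
  split_ifs
  · simpa using sq_nonneg (v j)
  · exact le_rfl

theorem Matrix.IsDiag.dropCol {D : Matrix (Fin n) (Fin n) ℝ} (hD : D.IsDiag) (i : Fin n) :
    (dropCol D i).IsDiag := by
  intro k j hkj
  simp [dropCol_apply, hD hkj]

end Euclidean

/-! ### Deterministic bounds on the resolvent -/

section Resolvent

variable {p n : ℕ}

/-- The triple `(X, D, Y)` satisfies the deterministic constraints of the model: `D` is diagonal,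
`‖X‖, ‖Y‖ ≤ √n κ` and `‖D‖ ≤ κD` in spectral norm. -/
structure Admissible (κ κD : ℝ) (X : Matrix (Fin p) (Fin n) ℝ) (D : Matrix (Fin n) (Fin n) ℝ)
    (Y : Matrix (Fin p) (Fin n) ℝ) : Prop where
  left : matSpectralNorm X ≤ √n * κ
  right : matSpectralNorm Y ≤ √n * κ
  diag : D.IsDiag
  mid : matSpectralNorm D ≤ κD

theorem Admissible.dropCol {κ κD : ℝ} {X Y : Matrix (Fin p) (Fin n) ℝ}
    {D : Matrix (Fin n) (Fin n) ℝ} (h : Admissible κ κD X D Y) (i : Fin n) :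
    Admissible κ κD (dropCol X i) (dropCol D i) (dropCol Y i) :=
  ⟨(matSpectralNorm_dropCol_le _ _).trans h.left, (matSpectralNorm_dropCol_le _ _).trans h.right,
    h.diag.dropCol i, (matSpectralNorm_dropCol_le _ _).trans h.mid⟩

variable {κ κD ε : ℝ} {X Y X' Y' : Matrix (Fin p) (Fin n) ℝ} {D D' : Matrix (Fin n) (Fin n) ℝ}

theorem norm_le_norm_resolventDenom (hn : 0 < n) (hκD : κ ^ 2 * κD ≤ 1 - ε)
    (h : Admissible κ κD X D Y) (v : EuclideanSpace ℝ (Fin p)) :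
    ε * ‖v‖ ≤ ‖toEuclideanLin (resolventDenom X D Y) v‖ := by
  have hn' : (0 : ℝ) < n := by exact_mod_cast hn
  have h1 : toEuclideanLin (resolventDenom X D Y) v = v - (1 / (n : ℝ)) •
      toEuclideanLin X (toEuclideanLin D (toEuclideanLin Yᵀ v)) := by
    rw [resolventDenom, map_sub, map_smul, LinearMap.sub_apply, LinearMap.smul_apply,
      toEuclideanLin_mul_apply, toEuclideanLin_mul_apply]
    simp
  have h2 : ‖toEuclideanLin X (toEuclideanLin D (toEuclideanLin Yᵀ v))‖ ≤
      √n * κ * (κD * (√n * κ * ‖v‖)) :=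
    norm_toEuclideanLin_le_of_le h.left (norm_toEuclideanLin_le_of_le h.mid
      (norm_toEuclideanLin_le_of_le ((matSpectralNorm_transpose_le Y).trans h.right) le_rfl))
  have h3 : √n * κ * (κD * (√n * κ * ‖v‖)) = n * (κ ^ 2 * κD * ‖v‖) := by
    have := Real.mul_self_sqrt hn'.le
    linear_combination (κ ^ 2 * κD * ‖v‖) * this
  have h4 : ‖(1 / (n : ℝ)) • toEuclideanLin X (toEuclideanLin D (toEuclideanLin Yᵀ v))‖ ≤
      (1 - ε) * ‖v‖ := by
    rw [norm_smul, Real.norm_of_nonneg (by positivity)]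
    calc 1 / (n : ℝ) * ‖toEuclideanLin X (toEuclideanLin D (toEuclideanLin Yᵀ v))‖
        ≤ 1 / (n : ℝ) * (n * (κ ^ 2 * κD * ‖v‖)) := by rw [← h3]; gcongr
      _ = κ ^ 2 * κD * ‖v‖ := by field_simp
      _ ≤ _ := by gcongr
  rw [h1]
  have := norm_sub_norm_le v
    ((1 / (n : ℝ)) • toEuclideanLin X (toEuclideanLin D (toEuclideanLin Yᵀ v)))
  linarith

theorem isUnit_resolventDenom (hn : 0 < n) (hε : 0 < ε) (hκD : κ ^ 2 * κD ≤ 1 - ε)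
    (h : Admissible κ κD X D Y) : IsUnit (resolventDenom X D Y) := by
  rw [← Matrix.mulVec_injective_iff_isUnit]
  refine (injective_iff_map_eq_zero (Matrix.mulVecLin (resolventDenom X D Y))).2 fun v hv => ?_
  have h1 := norm_le_norm_resolventDenom hn hκD h (WithLp.toLp 2 v)
  have h2 : toEuclideanLin (resolventDenom X D Y) (WithLp.toLp 2 v) = 0 := by
    rw [Matrix.toLpLin_apply]
    simpa using hv
  rw [h2, norm_zero] at h1
  have h3 : ‖(WithLp.toLp 2 v : EuclideanSpace ℝ (Fin p))‖ = 0 :=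
    le_antisymm (by by_contra! h4; exact absurd h1 (not_le.2 (mul_pos hε h4))) (norm_nonneg _)
  simpa using h3

theorem matSpectralNorm_resolventQ_le (hn : 0 < n) (hε : 0 < ε) (hκD : κ ^ 2 * κD ≤ 1 - ε)
    (h : Admissible κ κD X D Y) : matSpectralNorm (resolventQ X D Y) ≤ ε⁻¹ := by
  refine matSpectralNorm_le (inv_nonneg.2 hε.le) fun v => ?_
  have h1 := norm_le_norm_resolventDenom hn hκD h (toEuclideanLin (resolventQ X D Y) v)
  rw [← toEuclideanLin_mul_apply, resolventQ,
    Matrix.mul_nonsing_inv _ ((Matrix.isUnit_iff_isUnit_det _).1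
      (isUnit_resolventDenom hn hε hκD h))] at h1
  rw [inv_mul_eq_div, le_div_iff₀ hε, mul_comm]
  simpa [resolventQ] using h1

/-- The resolvent identity, applied to a vector. -/
theorem resolventQ_sub (hX : IsUnit (resolventDenom X D Y)) (hX' : IsUnit (resolventDenom X' D' Y'))
    (u : EuclideanSpace ℝ (Fin p)) :
    toEuclideanLin (resolventQ X D Y) u - toEuclideanLin (resolventQ X' D' Y') u =
      (1 / (n : ℝ)) • toEuclideanLin (resolventQ X D Y) (toEuclideanLin (X * D * Yᵀ - X' * D' * Y'ᵀ)
        (toEuclideanLin (resolventQ X' D' Y') u)) := by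
  have h1 : resolventQ X D Y - resolventQ X' D' Y' = (1 / (n : ℝ)) •
      (resolventQ X D Y * ((X * D * Yᵀ - X' * D' * Y'ᵀ) * resolventQ X' D' Y')) := by
    have h2 : (1 / (n : ℝ)) • (X * D * Yᵀ - X' * D' * Y'ᵀ) =
        resolventDenom X' D' Y' - resolventDenom X D Y := by
      simp only [resolventDenom, smul_sub]; abel
    rw [← Matrix.mul_smul, ← Matrix.smul_mul, h2, Matrix.sub_mul, Matrix.mul_sub,
      ← Matrix.mul_assoc, ← Matrix.mul_assoc, resolventQ, resolventQ,
      Matrix.nonsing_inv_mul _ ((Matrix.isUnit_iff_isUnit_det _).1 hX), Matrix.mul_assoc _ _ (_⁻¹),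
      Matrix.mul_nonsing_inv _ ((Matrix.isUnit_iff_isUnit_det _).1 hX')]
    simp
  rw [← LinearMap.sub_apply, ← map_sub, h1, map_smul, LinearMap.smul_apply,
    toEuclideanLin_mul_apply, toEuclideanLin_mul_apply]

/-- The map `(X, D, Y) ↦ Q u` is Lipschitz with constant `O((1 + s) / √n)` on the set of admissible
triples with `sup_i |y_iᵀ Q u| ≤ s`; the increment in `D` is the only one in which `s` is used. -/
theorem norm_resolventQ_sub_le (hn : 0 < n) (hε : 0 < ε) (hκD : κ ^ 2 * κD ≤ 1 - ε)
    (h : Admissible κ κD X D Y) (h' : Admissible κ κD X' D' Y') {u : EuclideanSpace ℝ (Fin p)}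
    {s : ℝ} (hs : 0 ≤ s)
    (hsup : ∀ i, |inner ℝ (colVec Y' i) (toEuclideanLin (resolventQ X' D' Y') u)| ≤ s) :
    ‖toEuclideanLin (resolventQ X D Y) u - toEuclideanLin (resolventQ X' D' Y') u‖ ≤
      ε⁻¹ * κ * (2 * κD * ε⁻¹ * ‖u‖ + s) / √n * ‖(X, D, Y) - (X', D', Y')‖ := by
  have hn' : (0 : ℝ) < n := by exact_mod_cast hn
  set N := ‖(X, D, Y) - (X', D', Y')‖ with hN
  have hNX : ‖X - X'‖ ≤ N := by rw [hN]; exact norm_fst_le ((X, D, Y) - (X', D', Y'))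
  have hNDY : ‖(D, Y) - (D', Y')‖ ≤ N := norm_snd_le ((X, D, Y) - (X', D', Y'))
  have hND : ‖D - D'‖ ≤ N := (norm_fst_le ((D, Y) - (D', Y'))).trans hNDY
  have hNY : ‖Y - Y'‖ ≤ N := (norm_snd_le ((D, Y) - (D', Y'))).trans hNDY
  rw [resolventQ_sub (isUnit_resolventDenom hn hε hκD h) (isUnit_resolventDenom hn hε hκD h')]
  set q := toEuclideanLin (resolventQ X' D' Y') u with hq
  have hqn : ‖q‖ ≤ ε⁻¹ * ‖u‖ :=
    norm_toEuclideanLin_le_of_le (matSpectralNorm_resolventQ_le hn hε hκD h') le_rfl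
  have hsplit : X * D * Yᵀ - X' * D' * Y'ᵀ =
      (X - X') * (D' * Y'ᵀ) + X * ((D - D') * Y'ᵀ) + X * (D * (Y - Y')ᵀ) := by
    simp only [Matrix.transpose_sub, Matrix.sub_mul, Matrix.mul_sub, Matrix.mul_assoc]; abel
  have b1 : ‖toEuclideanLin ((X - X') * (D' * Y'ᵀ)) q‖ ≤ N * (κD * (√n * κ * (ε⁻¹ * ‖u‖))) := by
    rw [toEuclideanLin_mul_apply, toEuclideanLin_mul_apply]
    exact norm_toEuclideanLin_le_of_le ((matSpectralNorm_le_frobenius _).trans hNX)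
      (norm_toEuclideanLin_le_of_le h'.mid (norm_toEuclideanLin_le_of_le
        ((matSpectralNorm_transpose_le Y').trans h'.right) hqn))
  have b2 : ‖toEuclideanLin (X * ((D - D') * Y'ᵀ)) q‖ ≤ √n * κ * (N * s) := by
    rw [toEuclideanLin_mul_apply, toEuclideanLin_mul_apply]
    refine norm_toEuclideanLin_le_of_le h.left (((h.diag.sub h'.diag).norm_toEuclideanLin_le hs
      fun i => ?_).trans (by gcongr))
    rw [toEuclideanLin_transpose_apply]
    exact hsup i
  have b3 : ‖toEuclideanLin (X * (D * (Y - Y')ᵀ)) q‖ ≤ √n * κ * (κD * (N * (ε⁻¹ * ‖u‖))) := by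
    rw [toEuclideanLin_mul_apply, toEuclideanLin_mul_apply]
    exact norm_toEuclideanLin_le_of_le h.left (norm_toEuclideanLin_le_of_le h.mid
      (norm_toEuclideanLin_le_of_le ((matSpectralNorm_transpose_le _).trans
        ((matSpectralNorm_le_frobenius _).trans hNY)) hqn))
  have b : ‖toEuclideanLin (X * D * Yᵀ - X' * D' * Y'ᵀ) q‖ ≤
      √n * (κ * (2 * κD * ε⁻¹ * ‖u‖ + s) * N) := by
    rw [hsplit, map_add, map_add, LinearMap.add_apply, LinearMap.add_apply]
    refine (norm_add₃_le.trans (add_le_add_three b1 b2 b3)).trans (le_of_eq ?_)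
    ring
  rw [norm_smul, Real.norm_of_nonneg (by positivity)]
  calc 1 / (n : ℝ) * _ ≤ 1 / (n : ℝ) * (ε⁻¹ * (√n * (κ * (2 * κD * ε⁻¹ * ‖u‖ + s) * N))) := by
        gcongr
        exact norm_toEuclideanLin_le_of_le (matSpectralNorm_resolventQ_le hn hε hκD h) b
    _ = _ := by
        have hr : (0 : ℝ) < √n := Real.sqrt_pos.2 hn'
        nth_rewrite 1 [← Real.mul_self_sqrt hn'.le]
        field_simp

/-- `X D Yᵀ` is the sum of its part without the `i`-th columns and the rank-one term
`D_i x_i y_iᵀ`. -/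
theorem toEuclideanLin_sub_dropCol (hD : D.IsDiag) (i : Fin n) (v : EuclideanSpace ℝ (Fin p)) :
    toEuclideanLin (X * D * Yᵀ - dropCol X i * dropCol D i * (dropCol Y i)ᵀ) v =
      (D i i * inner ℝ (colVec Y i) v) • colVec X i := by
  have key : ∀ (X Y : Matrix (Fin p) (Fin n) ℝ) (D : Matrix (Fin n) (Fin n) ℝ), D.IsDiag →
      ∀ k, toEuclideanLin (X * D * Yᵀ) v k =
        ∑ j, D j j * inner ℝ (colVec Y j) v * X k j := by
    intro X Y D hD k
    rw [toEuclideanLin_mul_apply, toEuclideanLin_mul_apply]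
    rw [Matrix.toLpLin_apply _ _ X]
    simp only [Matrix.mulVec, dotProduct]
    refine Finset.sum_congr rfl fun j _ => ?_
    rw [hD.toEuclideanLin_apply, toEuclideanLin_transpose_apply]
    ring
  ext k
  rw [map_sub, LinearMap.sub_apply, PiLp.sub_apply, key X Y D hD, key _ _ _ (hD.dropCol i),
    ← Finset.sum_sub_distrib, Finset.sum_eq_single i]
  · simp [dropCol_apply, colVec]
  · intro j _ hj
    simp [dropCol_apply, colVec, hj]
  · simp

/-- Leave-one-out bound. Let `Q₁` be the resolvent built from `X_{-i}`, `Y_{-i}` and a diagonal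
matrix `C` close to `D_{-i}` in Frobenius norm. Control of `y_i` against `Q₁ u` and against the
vectors `Q₁ x_j`, `j ≠ i`, of norm `O(√n)`, gives control of `y_iᵀ Q u`; for `j = i` the column of
`X_{-i}` is zero. -/
theorem abs_inner_resolventQ_le (hn : 0 < n) (hε : 0 < ε) (hκD : κ ^ 2 * κD ≤ 1 - ε)
    (h : Admissible κ κD X D Y) (i : Fin n)
    {C : Matrix (Fin n) (Fin n) ℝ} (hC : C.IsDiag) (hCn : matSpectralNorm C ≤ κD) {K : ℝ}
    (hK : ‖dropCol D i - C‖ ≤ K) {u : EuclideanSpace ℝ (Fin p)} {a b : ℝ}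
    (ha : |inner ℝ (colVec Y i)
      (toEuclideanLin (resolventQ (dropCol X i) C (dropCol Y i)) u)| ≤ a)
    (hb : ∀ j, |inner ℝ (colVec Y i)
      (toEuclideanLin (resolventQ (dropCol X i) C (dropCol Y i)) (colVec (dropCol X i) j))| ≤ b) :
    |inner ℝ (colVec Y i) (toEuclideanLin (resolventQ X D Y) u)| ≤
      ε⁻¹ * (a + K * b * (κ * ε⁻¹ * ‖u‖) / √n) := by
  have hn' : (0 : ℝ) < n := by exact_mod_cast hn
  have hr : (0 : ℝ) < √n := Real.sqrt_pos.2 hn'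
  have hrr : √n * √n = n := Real.mul_self_sqrt hn'.le
  have h2 : Admissible κ κD (dropCol X i) (dropCol D i) (dropCol Y i) := h.dropCol i
  have h1 : Admissible κ κD (dropCol X i) C (dropCol Y i) := ⟨h2.left, h2.right, hC, hCn⟩
  have hQ := matSpectralNorm_resolventQ_le hn hε hκD h
  have hQ2 := matSpectralNorm_resolventQ_le hn hε hκD h2
  have hU := isUnit_resolventDenom hn hε hκD h
  have hU1 := isUnit_resolventDenom hn hε hκD h1
  have hU2 := isUnit_resolventDenom hn hε hκD h2
  have hy : ‖colVec Y i‖ ≤ √n * κ := (norm_colVec_le Y i).trans h.right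
  have hx : ‖colVec X i‖ ≤ √n * κ := (norm_colVec_le X i).trans h.left
  have hb0 : 0 ≤ b := (abs_nonneg _).trans (hb i)
  have hK0 : 0 ≤ K := (norm_nonneg _).trans hK
  set y := colVec Y i with hydef
  set Q := resolventQ X D Y
  set Q₁ := resolventQ (dropCol X i) C (dropCol Y i) with hQ₁
  set Q₂ := resolventQ (dropCol X i) (dropCol D i) (dropCol Y i)
  -- replacing `C` by `D_{-i}` costs a bilinear form in `D_{-i} - C`
  have step1 : |inner ℝ y (toEuclideanLin Q₁ u) - inner ℝ y (toEuclideanLin Q₂ u)| ≤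
      K * b * (κ * ε⁻¹ * ‖u‖) / √n := by
    set q := toEuclideanLin (dropCol Y i)ᵀ (toEuclideanLin Q₂ u)
    have hq : ‖q‖ ≤ √n * κ * (ε⁻¹ * ‖u‖) :=
      norm_toEuclideanLin_le_of_le ((matSpectralNorm_transpose_le _).trans h2.right)
        (norm_toEuclideanLin_le_of_le hQ2 le_rfl)
    set w := toEuclideanLin (Q₁ * dropCol X i)ᵀ y with hw
    have hCD : (C - dropCol D i).IsDiag := hC.sub h2.diag
    have hwn : ‖toEuclideanLin (C - dropCol D i) w‖ ≤ K * b := by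
      refine (hCD.norm_toEuclideanLin_le hb0 fun j => ?_).trans
        (mul_le_mul_of_nonneg_right (by rwa [norm_sub_rev]) hb0)
      rw [hw, toEuclideanLin_transpose_apply, colVec_eq, toEuclideanLin_mul_apply, ← colVec_eq,
        real_inner_comm]
      exact hb j
    have hfac : dropCol X i * C * (dropCol Y i)ᵀ - dropCol X i * dropCol D i * (dropCol Y i)ᵀ =
        dropCol X i * ((C - dropCol D i) * (dropCol Y i)ᵀ) := by
      simp only [Matrix.mul_sub, Matrix.sub_mul, Matrix.mul_assoc]
    have hkey : inner ℝ y (toEuclideanLin Q₁ u) - inner ℝ y (toEuclideanLin Q₂ u) =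
        1 / (n : ℝ) * inner ℝ (toEuclideanLin (C - dropCol D i) w) q := by
      rw [← inner_sub_right, resolventQ_sub hU1 hU2, inner_smul_right, hfac,
        toEuclideanLin_mul_apply, toEuclideanLin_mul_apply]
      congr 1
      rw [← toEuclideanLin_mul_apply, ← inner_toEuclideanLin_transpose,
        ← inner_toEuclideanLin_transpose, hCD.isSymm.eq]
    rw [hkey, abs_mul, abs_of_nonneg (by positivity : (0 : ℝ) ≤ 1 / n)]
    calc 1 / (n : ℝ) * |inner ℝ (toEuclideanLin (C - dropCol D i) w) q|
        ≤ 1 / (n : ℝ) * (K * b * (√n * κ * (ε⁻¹ * ‖u‖))) := by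
          gcongr
          exact (abs_real_inner_le_norm _ _).trans
            (mul_le_mul hwn hq (norm_nonneg _) (mul_nonneg hK0 hb0))
      _ = _ := by
          nth_rewrite 1 [← hrr]; field_simp
  -- the rank-one term is a bounded multiple of `y_iᵀ Q₂ u`
  have step2 : |inner ℝ y (toEuclideanLin Q u)| ≤ ε⁻¹ * |inner ℝ y (toEuclideanLin Q₂ u)| := by
    have hkey : inner ℝ y (toEuclideanLin Q u) = inner ℝ y (toEuclideanLin Q₂ u) *
        (1 + 1 / (n : ℝ) * (D i i * inner ℝ y (toEuclideanLin Q (colVec X i)))) := by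
      have h3 := resolventQ_sub hU hU2 u
      rw [toEuclideanLin_sub_dropCol h.diag, map_smul] at h3
      rw [eq_add_of_sub_eq h3, inner_add_right, inner_smul_right, inner_smul_right]
      ring
    have hcoef : |1 / (n : ℝ) * (D i i * inner ℝ y (toEuclideanLin Q (colVec X i)))| ≤
        ε⁻¹ * (κ ^ 2 * κD) := by
      rw [abs_mul, abs_mul, abs_of_nonneg (by positivity : (0 : ℝ) ≤ 1 / n)]
      calc 1 / (n : ℝ) * (|D i i| * |inner ℝ y (toEuclideanLin Q (colVec X i))|)
          ≤ 1 / (n : ℝ) * (κD * (√n * κ * (ε⁻¹ * (√n * κ)))) := by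
            gcongr
            · exact (matSpectralNorm_nonneg D).trans h.mid
            · exact (abs_apply_le_matSpectralNorm D i i).trans h.mid
            · exact (abs_real_inner_le_norm _ _).trans
                (mul_le_mul hy (norm_toEuclideanLin_le_of_le hQ hx) (norm_nonneg _)
                  ((norm_nonneg _).trans hy))
        _ = _ := by nth_rewrite 1 [← hrr]; field_simp
    have hle : ε⁻¹ * (κ ^ 2 * κD) ≤ ε⁻¹ - 1 := by
      calc ε⁻¹ * (κ ^ 2 * κD) ≤ ε⁻¹ * (1 - ε) := by gcongr
        _ = _ := by field_simp
    rw [hkey, abs_mul, mul_comm]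
    gcongr
    refine (abs_add_le _ _).trans ?_
    rw [abs_one]
    linarith
  refine step2.trans (mul_le_mul_of_nonneg_left ?_ (inv_nonneg.2 hε.le))
  have h4 := abs_sub_abs_le_abs_sub (inner ℝ y (toEuclideanLin Q₂ u))
    (inner ℝ y (toEuclideanLin Q₁ u))
  rw [abs_sub_comm] at h4
  linarith

end Resolvent

/-! ### Consequences of Lipschitz concentration for one measure -/

section Concentration

variable {Ω : Type*} [MeasurableSpace Ω] {μ : Measure Ω} [IsProbabilityMeasure μ]

theorem integrableOn_gaussian_tail {C c : ℝ} (hc : 0 < c) :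
    IntegrableOn (fun t : ℝ => C * Real.exp (-(t / c) ^ 2)) (Set.Ioi 0) := by
  refine (Integrable.const_mul ?_ C).integrableOn
  refine (integrable_exp_neg_mul_sq (b := (c ^ 2)⁻¹) (by positivity)).congr
    (Filter.Eventually.of_forall fun t => ?_)
  simp only
  congr 1
  field_simp

/-- Gaussian tails of `Z - Z'`, for an independent copy `Z'` of `Z`, give Gaussian tails of `Z`
itself beyond a level that depends only on the constants and on a bound for the mean. The integral
`B` of the tail bound dominates `E|Z - Z'|`, so by Markov's inequality at least half of the mass lies
within `2 B + 1` of the mean. -/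
theorem measureReal_abs_ge_le_of_symmetrized {Z : Ω → ℝ} (hZ : Integrable Z μ) {C c : ℝ}
    (hC : 0 < C) (hc : 0 < c)
    (h : ∀ t : ℝ, 0 < t → (μ.prod μ).real {ω | t ≤ |Z ω.1 - Z ω.2|} ≤ C * Real.exp (-(t / c) ^ 2))
    {m : ℝ} (hm : |∫ ω, Z ω ∂μ| ≤ m) {t : ℝ} (ht : 0 < t) :
    μ.real {ω | t + (2 * (∫ r in Set.Ioi (0 : ℝ), C * Real.exp (-(r / c) ^ 2)) + 1 + m) ≤ |Z ω|} ≤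
      2 * C * Real.exp (-(t / c) ^ 2) := by
  set B := ∫ r in Set.Ioi (0 : ℝ), C * Real.exp (-(r / c) ^ 2) with hB
  set e := ∫ ω, Z ω ∂μ with he
  have hB0 : 0 ≤ B := integral_nonneg fun r => by positivity
  have hint : Integrable (fun ω : Ω × Ω => |Z ω.1 - Z ω.2|) (μ.prod μ) :=
    ((hZ.comp_fst μ).sub (hZ.comp_snd μ)).abs
  have h1 : ∫ ω, |Z ω.1 - Z ω.2| ∂(μ.prod μ) ≤ B := by
    rw [hint.integral_eq_integral_meas_le (Filter.Eventually.of_forall fun _ => abs_nonneg _)]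
    refine integral_mono_of_nonneg (Filter.Eventually.of_forall fun _ => measureReal_nonneg)
      (integrableOn_gaussian_tail hc) ?_
    filter_upwards [ae_restrict_mem measurableSet_Ioi] with r hr using h r hr
  have h2 : ∫ ω, |Z ω - e| ∂μ ≤ B := by
    rw [integral_prod _ hint] at h1
    refine le_trans (integral_mono (hZ.sub (integrable_const e)).abs hint.integral_prod_left
      fun ω => ?_) h1
    simp only
    have h3 : Z ω - e = ∫ ω', (Z ω - Z ω') ∂μ := by
      rw [integral_sub (integrable_const _) hZ]; simp [he]
    rw [h3]
    exact abs_integral_le_integral_abs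
  have h4 : μ.real {ω | 2 * B + 1 ≤ |Z ω - e|} ≤ 1 / 2 := by
    have h5 := mul_meas_ge_le_integral_of_nonneg (μ := μ)
      (Filter.Eventually.of_forall fun ω => abs_nonneg (Z ω - e))
      (hZ.sub (integrable_const e)).abs (2 * B + 1)
    have h6 : (2 * B + 1) * μ.real {ω | 2 * B + 1 ≤ |Z ω - e|} ≤ B := h5.trans h2
    have h7 := measureReal_nonneg (μ := μ) (s := {ω | 2 * B + 1 ≤ |Z ω - e|})
    nlinarith
  have h8 : 1 / 2 ≤ μ.real {ω | |Z ω - e| < 2 * B + 1} := by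
    have h9 : (1 : ℝ) ≤ μ.real {ω | |Z ω - e| < 2 * B + 1} +
        μ.real {ω | 2 * B + 1 ≤ |Z ω - e|} := by
      refine le_trans (le_of_eq ?_) (measureReal_union_le _ _)
      rw [← probReal_univ (μ := μ)]
      congr 1
      ext ω
      simpa using lt_or_ge _ _
    linarith
  have h10 : μ.real {ω | t + (2 * B + 1) ≤ |Z ω - e|} * μ.real {ω | |Z ω - e| < 2 * B + 1} ≤
      C * Real.exp (-(t / c) ^ 2) := by
    rw [← measureReal_prod_prod]
    refine (measureReal_mono fun ω hω => ?_).trans (h t ht)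
    obtain ⟨ha, hb⟩ := hω
    simp only [Set.mem_ofPred_eq] at ha hb ⊢
    have := abs_sub_abs_le_abs_sub (Z ω.1 - e) (Z ω.2 - e)
    rw [sub_sub_sub_cancel_right] at this
    linarith
  have h11 : μ.real {ω | t + (2 * B + 1 + m) ≤ |Z ω|} ≤
      μ.real {ω | t + (2 * B + 1) ≤ |Z ω - e|} := by
    refine measureReal_mono fun ω hω => ?_
    simp only [Set.mem_ofPred_eq] at hω ⊢
    have := abs_sub_abs_le_abs_sub (Z ω) e
    linarith
  have h12 := measureReal_nonneg (μ := μ) (s := {ω | t + (2 * B + 1) ≤ |Z ω - e|})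
  nlinarith

/-- A tail bound for `⟪w, V⟫`, uniform over deterministic `w` with `‖w‖ ≤ R`, holds for random `w`
independent of `V`. -/
theorem measureReal_inner_ge_le_of_indepFun {E : Type*} [NormedAddCommGroup E]
    [InnerProductSpace ℝ E] [MeasurableSpace E] [BorelSpace E] [SecondCountableTopology E]
    {W V : Ω → E} (hWm : Measurable W) (hVm : Measurable V) (hind : IndepFun W V μ) {R s η : ℝ}
    (hW : ∀ᵐ ω ∂μ, ‖W ω‖ ≤ R)
    (h : ∀ w : E, ‖w‖ ≤ R → μ.real {ω | s ≤ |inner ℝ w (V ω)|} ≤ η) :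
    μ.real {ω | s ≤ |inner ℝ (W ω) (V ω)|} ≤ η := by
  obtain ⟨ω₀, hω₀⟩ := hW.exists
  have hη : 0 ≤ η := measureReal_nonneg.trans (h _ hω₀)
  set S : Set (E × E) := {x | s ≤ |inner ℝ x.1 x.2|} with hS
  have hSm : MeasurableSet S :=
    measurableSet_le measurable_const (by fun_prop)
  refine ENNReal.toReal_le_of_le_ofReal hη ?_
  have h1 : μ {ω | s ≤ |inner ℝ (W ω) (V ω)|} = (μ.map fun ω => (W ω, V ω)) S := by
    rw [Measure.map_apply (hWm.prodMk hVm) hSm]; rfl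
  rw [h1, (indepFun_iff_map_prod_eq_prod_map_map hWm.aemeasurable hVm.aemeasurable).1 hind,
    Measure.prod_apply hSm]
  have : IsProbabilityMeasure (μ.map W) := Measure.isProbabilityMeasure_map hWm.aemeasurable
  calc ∫⁻ w, (μ.map V) (Prod.mk w ⁻¹' S) ∂(μ.map W)
      ≤ ∫⁻ _, ENNReal.ofReal η ∂(μ.map W) := by
        refine lintegral_mono_ae ?_
        have h2 : ∀ᵐ w ∂(μ.map W), ‖w‖ ≤ R :=
          (ae_map_iff hWm.aemeasurable (measurableSet_le measurable_norm measurable_const)).2 hW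
        filter_upwards [h2] with w hw
        rw [Measure.map_apply hVm (measurable_prodMk_left hSm)]
        rw [← ENNReal.ofReal_toReal (measure_ne_top μ _)]
        exact ENNReal.ofReal_le_ofReal (h w hw)
    _ = ENNReal.ofReal η := by simp

/-- Concentration passes to maps that are Lipschitz only on a set of large probability, which need
not be convex: extend the restriction to the whole space. -/
theorem concentration_of_lipschitz_on {E : Type*} [SeminormedAddCommGroup E] {Z : Ω → E}
    {C c : ℝ}
    (h : ∀ f : E → ℝ, LipschitzWith 1 f → ∀ t : ℝ, 0 < t →
      (μ.prod μ).real {ω | t ≤ |f (Z ω.1) - f (Z ω.2)|} ≤ C * Real.exp (-(t / c) ^ 2))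
    {G : E → ℝ} {S : Set E} {L : ℝ} (hL : 0 < L)
    (hG : ∀ z ∈ S, ∀ z' ∈ S, |G z - G z'| ≤ L * ‖z - z'‖) {t : ℝ} (ht : 0 < t) :
    (μ.prod μ).real {ω | t ≤ |G (Z ω.1) - G (Z ω.2)|} ≤
      2 * μ.real {ω | Z ω ∉ S} + C * Real.exp (-(t / L / c) ^ 2) := by
  have h1 : LipschitzOnWith 1 (fun z => G z / L) S := by
    refine LipschitzOnWith.of_dist_le_mul fun z hz z' hz' => ?_
    rw [NNReal.coe_one, one_mul, Real.dist_eq, ← sub_div, abs_div, abs_of_pos hL, div_le_iff₀ hL,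
      mul_comm, dist_eq_norm]
    exact hG z hz z' hz'
  obtain ⟨g, hg, hgS⟩ := h1.extend_real
  set Bad := {ω | Z ω ∉ S}
  have hsub : {ω : Ω × Ω | t ≤ |G (Z ω.1) - G (Z ω.2)|} ⊆
      (Bad ×ˢ Set.univ ∪ Set.univ ×ˢ Bad) ∪ {ω | t / L ≤ |g (Z ω.1) - g (Z ω.2)|} := by
    intro ω hω
    by_cases h1 : Z ω.1 ∈ S
    · by_cases h2 : Z ω.2 ∈ S
      · right
        simp only [Set.mem_ofPred_eq] at hω ⊢
        rw [← hgS h1, ← hgS h2, ← sub_div, abs_div, abs_of_pos hL]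
        gcongr
      · exact Or.inl (Or.inr ⟨trivial, h2⟩)
    · exact Or.inl (Or.inl ⟨h1, trivial⟩)
  refine (measureReal_mono hsub).trans ((measureReal_union_le _ _).trans
    (add_le_add ((measureReal_union_le _ _).trans (le_of_eq ?_)) (h g hg _ (div_pos ht hL))))
  rw [measureReal_prod_prod, measureReal_prod_prod, probReal_univ]
  ring

end Concentration

/-! ### Optimising the truncation level -/

/-- Choosing the truncation level `t = √(log n · τ)`, `τ = r √(n / log n)`, turns the sum of the
probability of leaving the truncated set and of the Gaussian tail into an exponential tail in `τ`. -/
theorem le_exp_of_forall_truncation {A a C b x r : ℝ} (hA : 0 < A) (ha : 0 < a) (hC : 0 < C)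
    (hb : 0 < b) {n : ℕ} (hn : 2 ≤ n) (hr : 0 < r) (hx : x ≤ 1)
    (h : ∀ t : ℝ, 0 < t → x ≤ A * n ^ 2 * Real.exp (-(t / a) ^ 2) +
      C * Real.exp (-(r * √n / (b * (1 + t))) ^ 2)) :
    x ≤ (A + C + Real.exp ((4 * a ^ 2 + 1) / (4 * a ^ 2 + 9 * b ^ 2))) *
      Real.exp (-(r / ((4 * a ^ 2 + 9 * b ^ 2) * √(Real.log n / n)))) := by
  set k := 4 * a ^ 2 + 9 * b ^ 2 with hk
  have hkpos : 0 < k := by positivity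
  have hn' : (0 : ℝ) < n := by exact_mod_cast (by omega : 0 < n)
  set l := Real.log n with hl
  have hl2 : 1 / 2 ≤ l := by
    have h1 : Real.log 2 ≤ l := Real.log_le_log (by norm_num) (by exact_mod_cast hn)
    have := Real.log_two_gt_d9
    linarith
  have hlpos : 0 < l := by linarith
  set σ := √(l / n) with hσ
  have hσpos : 0 < σ := Real.sqrt_pos.2 (by positivity)
  set τ := r / σ with hτ
  have hτpos : 0 < τ := by positivity
  have hrw : r / (k * σ) = τ / k := by rw [hτ]; field_simp
  rw [hrw]
  have he : ∀ y : ℝ, -(τ / k) ≥ y → Real.exp y ≤ Real.exp (-(τ / k)) :=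
    fun y hy => Real.exp_le_exp.2 hy
  have hpos := Real.exp_pos (-(τ / k))
  rcases le_or_gt (4 * a ^ 2 + 1) τ with hτ0 | hτ0
  · have ht2 : √(l * τ) ^ 2 = l * τ := Real.sq_sqrt (by positivity)
    have htpos : 0 < √(l * τ) := Real.sqrt_pos.2 (by positivity)
    have ht1 : 1 / 2 ≤ √(l * τ) := by
      apply Real.le_sqrt_of_sq_le
      nlinarith [sq_nonneg a]
    have key := h (√(l * τ)) htpos
    set t := √(l * τ)
    have e1 : (n : ℝ) ^ 2 * Real.exp (-(t / a) ^ 2) ≤ Real.exp (-(τ / k)) := by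
      have : (n : ℝ) ^ 2 = Real.exp (2 * l) := by
        rw [two_mul, Real.exp_add, hl, Real.exp_log hn', sq]
      rw [this, ← Real.exp_add]
      apply he
      rw [div_pow, ht2]
      have h1 : τ / k ≤ τ / (4 * a ^ 2) := by
        gcongr
        rw [hk]; nlinarith [sq_nonneg b]
      have h2 : 4 ≤ τ / a ^ 2 := by
        rw [le_div_iff₀ (by positivity)]; linarith
      have h3 : l * τ / a ^ 2 = l * (τ / a ^ 2) := by ring
      have h4 : τ / (4 * a ^ 2) = τ / a ^ 2 / 4 := by ring
      rw [h3]
      nlinarith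
    have e2 : Real.exp (-(r * √n / (b * (1 + t))) ^ 2) ≤ Real.exp (-(τ / k)) := by
      apply he
      have h1 : r * √n = τ * √l := by
        rw [hτ, hσ, Real.sqrt_div hlpos.le]
        have := Real.sqrt_pos.2 hn'
        have := Real.sqrt_pos.2 hlpos
        field_simp
      have h2 : (r * √n / (b * (1 + t))) ^ 2 = τ ^ 2 * l / (b ^ 2 * (1 + t) ^ 2) := by
        rw [h1, div_pow, mul_pow, mul_pow, Real.sq_sqrt hlpos.le]
      have h3 : (1 + t) ^ 2 ≤ 9 * (l * τ) := by rw [← ht2]; nlinarith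
      have h4 : τ / k ≤ τ / (9 * b ^ 2) := by
        gcongr
        rw [hk]; nlinarith [sq_nonneg a]
      have h5 : τ / (9 * b ^ 2) = τ ^ 2 * l / (b ^ 2 * (9 * (l * τ))) := by field_simp
      have h6 : τ ^ 2 * l / (b ^ 2 * (9 * (l * τ))) ≤ τ ^ 2 * l / (b ^ 2 * (1 + t) ^ 2) := by
        gcongr
      rw [h2]
      linarith
    calc x ≤ A * ((n : ℝ) ^ 2 * Real.exp (-(t / a) ^ 2)) +
          C * Real.exp (-(r * √n / (b * (1 + t))) ^ 2) := by rw [← mul_assoc]; exact key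
      _ ≤ A * Real.exp (-(τ / k)) + C * Real.exp (-(τ / k)) := by gcongr
      _ ≤ _ := by
        have := Real.exp_pos ((4 * a ^ 2 + 1) / k)
        nlinarith [mul_pos this hpos]
  · have h1 : 1 ≤ Real.exp ((4 * a ^ 2 + 1) / k) * Real.exp (-(τ / k)) := by
      rw [← Real.exp_add, ← sub_eq_add_neg, ← sub_div]
      exact Real.one_le_exp (div_nonneg (by linarith) hkpos.le)
    nlinarith [mul_pos hA hpos, mul_pos hC hpos]

/-! ### Measurability -/

section Measurability

variable {α : Type*} [MeasurableSpace α] {m n : ℕ}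

theorem measurable_matrix_iff {M : α → Matrix (Fin m) (Fin n) ℝ} :
    Measurable M ↔ ∀ i j, Measurable fun a => M a i j := by
  refine ⟨fun h i j => ?_, fun h => measurable_pi_iff.2 fun i => measurable_pi_iff.2 (h i)⟩
  exact (measurable_pi_iff.1 (measurable_pi_iff.1 h i)) j

theorem measurable_colVec (i : Fin n) :
    Measurable fun M : Matrix (Fin m) (Fin n) ℝ => colVec M i :=
  (WithLp.measurable_toLp 2 _).comp
    (measurable_pi_iff.2 fun k => measurable_matrix_iff.1 measurable_id k i)

theorem measurable_det {M : α → Matrix (Fin n) (Fin n) ℝ}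
    (hM : ∀ i j, Measurable fun a => M a i j) : Measurable fun a => (M a).det := by
  simp only [Matrix.det_apply]
  refine Finset.measurable_sum _ fun σ _ => Measurable.const_smul ?_ _
  exact Finset.measurable_prod _ fun i _ => hM _ _

theorem measurable_matrix_inv {M : α → Matrix (Fin n) (Fin n) ℝ}
    (hM : ∀ i j, Measurable fun a => M a i j) (i j : Fin n) :
    Measurable fun a => (M a)⁻¹ i j := by
  simp only [Matrix.inv_def, Matrix.smul_apply, Ring.inverse_eq_inv', smul_eq_mul,
    Matrix.adjugate_apply]
  refine (measurable_det hM).inv.mul (measurable_det fun k l => ?_)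
  simp only [Matrix.updateRow_apply]
  split_ifs
  · exact measurable_const
  · exact hM k l

theorem measurable_resolventQ_apply {X Y : α → Matrix (Fin m) (Fin n) ℝ}
    {D : α → Matrix (Fin n) (Fin n) ℝ} (hX : Measurable X) (hD : Measurable D) (hY : Measurable Y)
    {v : α → EuclideanSpace ℝ (Fin m)} (hv : Measurable v) :
    Measurable fun a => toEuclideanLin (resolventQ (X a) (D a) (Y a)) (v a) := by
  rw [measurable_matrix_iff] at hX hD hY
  have hden : ∀ i j, Measurable fun a => resolventDenom (X a) (D a) (Y a) i j := by
    intro i j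
    simp only [resolventDenom, Matrix.sub_apply, Matrix.smul_apply, Matrix.mul_apply,
      Matrix.transpose_apply]
    refine measurable_const.sub (Measurable.fun_const_smul ?_ _)
    refine Finset.measurable_sum _ fun k _ => ?_
    exact (Finset.measurable_sum _ fun l _ => (hX i l).mul (hD l k)).mul (hY j k)
  simp only [Matrix.toLpLin_apply]
  refine (WithLp.measurable_toLp 2 _).comp (measurable_pi_iff.2 fun i => ?_)
  simp only [Matrix.mulVec, dotProduct]
  refine Finset.measurable_sum _ fun k _ => (measurable_matrix_inv hden i k).mul ?_
  exact (measurable_pi_iff.1 ((WithLp.measurable_ofLp 2 _).comp hv)) k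

end Measurability

/-! ### Truncation of the entries -/

section Truncation

variable {m n : ℕ}

/-- The matrix `M` with its entries truncated to `[-b, b]`. -/
noncomputable def clipEntries (b : ℝ) (M : Matrix (Fin m) (Fin n) ℝ) : Matrix (Fin m) (Fin n) ℝ :=
  M.map fun x => max (-b) (min b x)

theorem isDiag_clipEntries {b : ℝ} (hb : 0 ≤ b) {M : Matrix (Fin n) (Fin n) ℝ}
    (hM : M.IsDiag) : (clipEntries b M).IsDiag := by
  intro i j hij
  simp [clipEntries, hM hij, hb]

theorem matSpectralNorm_clipEntries_le {b : ℝ} (hb : 0 ≤ b)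
    {M : Matrix (Fin n) (Fin n) ℝ} (hM : M.IsDiag) : matSpectralNorm (clipEntries b M) ≤ b := by
  refine (isDiag_clipEntries hb hM).matSpectralNorm_le hb fun i => abs_le.2 ⟨le_max_left _ _, ?_⟩
  exact max_le (by linarith) (min_le_left _ _)

/-- Truncation is a contraction that fixes the matrices with entries in `[-b, b]`. -/
theorem norm_sub_clipEntries_le {b : ℝ} {A M : Matrix (Fin m) (Fin n) ℝ}
    (hA : ∀ i j, |A i j| ≤ b) : ‖A - clipEntries b M‖ ≤ ‖A - M‖ := by
  refine le_of_sq_le_sq ?_ (norm_nonneg _)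
  rw [frobenius_norm_sq, frobenius_norm_sq]
  refine Finset.sum_le_sum fun i _ => Finset.sum_le_sum fun j _ => sq_le_sq.2 ?_
  have h1 : A i j = max (-b) (min b (A i j)) := by
    rw [min_eq_right (abs_le.1 (hA i j)).2, max_eq_right (abs_le.1 (hA i j)).1]
  simp only [Matrix.sub_apply, clipEntries, Matrix.map_apply]
  nth_rewrite 1 [h1]
  refine (abs_max_sub_max_le_max _ _ _ _).trans (max_le (by simp) ?_)
  exact (abs_min_sub_min_le_max _ _ _ _).trans (max_le (by simp) le_rfl)

theorem measurable_clipEntries_dropCol (b : ℝ) (i : Fin n) :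
    Measurable fun M : Matrix (Fin m) (Fin n) ℝ => clipEntries b (dropCol M i) := by
  refine measurable_matrix_iff.2 fun k l => ?_
  simp only [clipEntries, Matrix.map_apply, dropCol_apply]
  refine measurable_const.max (measurable_const.min ?_)
  split_ifs
  · exact measurable_const
  · exact measurable_matrix_iff.1 measurable_id k l

end Truncation

/-! ### The columns of `Y` against `Q u` -/

section LeaveOneOut

variable {Ω : Type*} [MeasurableSpace Ω] {μ : Measure Ω} [IsProbabilityMeasure μ] {p n : ℕ}

/-- A bound for the probability that `|⟪w, y_i⟫| ≥ s`, uniform over `i` and over deterministic unit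
vectors `w`, controls the probability that `sup_i |y_iᵀ Q u|` exceeds a constant multiple of `s`:
a union bound over the `n (n + 1)` forms `⟪Q₁ u, y_i⟫`, `⟪Q₁ x_j, y_i⟫`, in which the resolvent `Q₁`
without the `i`-th columns is independent of `y_i`. -/
theorem measureReal_sup_inner_resolventQ_le (hn : 0 < n)
    {X Y : Ω → Matrix (Fin p) (Fin n) ℝ} {D : Ω → Matrix (Fin n) (Fin n) ℝ}
    (hXm : Measurable X) (hYm : Measurable Y)
    {Di : Fin n → Ω → Matrix (Fin n) (Fin n) ℝ} (hDim : ∀ i, Measurable (Di i))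
    (hDid : ∀ i ω, (Di i ω).IsDiag)
    (hind : ∀ i, IndepFun (fun ω => (Di i ω, dropCol (X ω) i, dropCol (Y ω) i))
        (fun ω => (colVec (X ω) i, colVec (Y ω) i)) μ)
    {K : ℝ} (hK : ∀ᵐ ω ∂μ, ∀ i, ‖dropCol (D ω) i - dropCol (Di i ω) i‖ ≤ K)
    {κ κD ε : ℝ} (hκ : 0 < κ) (hκD0 : 0 ≤ κD) (hε : 0 < ε) (hκD : κ ^ 2 * κD ≤ 1 - ε)
    (hadm : ∀ᵐ ω ∂μ, Admissible κ κD (X ω) (D ω) (Y ω))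
    {s η : ℝ}
    (hsub : ∀ i (w : EuclideanSpace ℝ (Fin p)), ‖w‖ ≤ 1 →
      μ.real {ω | s ≤ |inner ℝ w (colVec (Y ω) i)|} ≤ η)
    {u : EuclideanSpace ℝ (Fin p)} {U : ℝ} (hU : 0 < U) (hu : ‖u‖ ≤ U) :
    μ.real {ω | ¬ (Admissible κ κD (X ω) (D ω) (Y ω) ∧ ∀ i,
        |inner ℝ (colVec (Y ω) i) (toEuclideanLin (resolventQ (X ω) (D ω) (Y ω)) u)| ≤
          ε⁻¹ * (ε⁻¹ * U + K * (κ * ε⁻¹) ^ 2 * U) * s)} ≤ 2 * n ^ 2 * η := by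
  have hn1 : (1 : ℝ) ≤ n := by exact_mod_cast hn
  have hr : (0 : ℝ) < √n := Real.sqrt_pos.2 (by linarith)
  set C : Fin n → Ω → Matrix (Fin n) (Fin n) ℝ :=
    fun i ω => clipEntries κD (dropCol (Di i ω) i) with hCdef
  have hCdiag : ∀ i ω, (C i ω).IsDiag := fun i ω => isDiag_clipEntries hκD0 ((hDid i ω).dropCol i)
  have hCn : ∀ i ω, matSpectralNorm (C i ω) ≤ κD :=
    fun i ω => matSpectralNorm_clipEntries_le hκD0 ((hDid i ω).dropCol i)
  -- the deterministic vector `u` is labelled by `none`, the columns of `X_{-i}` by `some j`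
  set V : Fin n → Option (Fin n) → Ω → EuclideanSpace ℝ (Fin p) :=
    fun i o ω => o.elim u (fun j => colVec (dropCol (X ω) i) j) with hVdef
  set R : Option (Fin n) → ℝ := fun o => o.elim (ε⁻¹ * U) (fun _ => ε⁻¹ * (√n * κ)) with hRdef
  have hRpos : ∀ o, 0 < R o := by rintro (_ | j) <;> simp only [hRdef, Option.elim] <;> positivity
  set W : Fin n → Option (Fin n) → Ω → EuclideanSpace ℝ (Fin p) := fun i o ω =>
    toEuclideanLin (resolventQ (dropCol (X ω) i) (C i ω) (dropCol (Y ω) i)) (V i o ω) with hWdef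
  have hYim : ∀ i, Measurable fun ω => colVec (Y ω) i := fun i => (measurable_colVec i).comp hYm
  have hdropm : ∀ {Z : Ω → Matrix (Fin p) (Fin n) ℝ}, Measurable Z → ∀ i,
      Measurable fun ω => dropCol (Z ω) i := by
    intro Z hZ i
    refine measurable_matrix_iff.2 fun k l => ?_
    simp only [dropCol_apply]
    split_ifs
    · exact measurable_const
    · exact measurable_matrix_iff.1 hZ k l
  have hevent : ∀ i o, μ.real {ω | R o * s ≤ |inner ℝ (W i o ω) (colVec (Y ω) i)|} ≤ η := by
    intro i o
    -- `W i o` is a measurable function of the triple that is independent of `(x_i, y_i)`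
    obtain ⟨Φ, hΦm, hΦ⟩ : ∃ Φ : Matrix (Fin n) (Fin n) ℝ × Matrix (Fin p) (Fin n) ℝ ×
        Matrix (Fin p) (Fin n) ℝ → EuclideanSpace ℝ (Fin p), Measurable Φ ∧
        ∀ ω, W i o ω = Φ (Di i ω, dropCol (X ω) i, dropCol (Y ω) i) := by
      refine ⟨fun x => toEuclideanLin (resolventQ x.2.1 (clipEntries κD (dropCol x.1 i)) x.2.2)
        (o.elim u (fun j => colVec x.2.1 j)), ?_, fun ω => rfl⟩
      refine measurable_resolventQ_apply (measurable_fst.comp measurable_snd)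
        ((measurable_clipEntries_dropCol κD i).comp measurable_fst)
        (measurable_snd.comp measurable_snd) ?_
      rcases o with _ | j
      · exact measurable_const
      · exact (measurable_colVec j).comp (measurable_fst.comp measurable_snd)
    have hWm : Measurable (W i o) := by
      rw [funext hΦ]
      exact hΦm.comp ((hDim i).prodMk ((hdropm hXm i).prodMk (hdropm hYm i)))
    have hWind : IndepFun (W i o) (fun ω => colVec (Y ω) i) μ := by
      rw [funext hΦ]
      exact (hind i).comp hΦm measurable_snd
    refine measureReal_inner_ge_le_of_indepFun hWm (hYim i) hWind (R := R o) ?_ fun w hw => ?_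
    · filter_upwards [hadm] with ω hω
      have h1 : Admissible κ κD (dropCol (X ω) i) (C i ω) (dropCol (Y ω) i) :=
        ⟨(hω.dropCol i).left, (hω.dropCol i).right, hCdiag i ω, hCn i ω⟩
      have hQ := matSpectralNorm_resolventQ_le hn hε hκD h1
      rcases o with _ | j
      · exact norm_toEuclideanLin_le_of_le hQ hu
      · exact norm_toEuclideanLin_le_of_le hQ ((norm_colVec_le _ j).trans (hω.dropCol i).left)
    · refine (measureReal_mono fun ω hω => ?_).trans (hsub i ((R o)⁻¹ • w) ?_)
      · simp only [Set.mem_ofPred_eq] at hω ⊢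
        rw [inner_smul_left, abs_mul, conj_trivial, abs_of_pos (inv_pos.2 (hRpos o)),
          inv_mul_eq_div, le_div_iff₀ (hRpos o), mul_comm]
        exact hω
      · rw [norm_smul, norm_inv, Real.norm_of_nonneg (hRpos o).le, inv_mul_eq_div,
          div_le_one (hRpos o)]
        exact hw
  have hη : 0 ≤ η := measureReal_nonneg.trans (hevent ⟨0, hn⟩ none)
  calc _ ≤ μ.real (⋃ x : Fin n × Option (Fin n),
        {ω | R x.2 * s ≤ |inner ℝ (W x.1 x.2 ω) (colVec (Y ω) x.1)|}) := by
        refine ENNReal.toReal_mono (measure_ne_top _ _) (measure_mono_ae ?_)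
        filter_upwards [hadm, hK] with ω hω hKω hbad
        by_contra hgood
        refine hbad ⟨hω, fun i => ?_⟩
        have hlt : ∀ o, |inner ℝ (colVec (Y ω) i) (W i o ω)| ≤ R o * s := by
          intro o
          rw [real_inner_comm]
          by_contra! hlt
          exact hgood (Set.mem_iUnion.2 ⟨(i, o), hlt.le⟩)
        have hCK : ‖dropCol (D ω) i - C i ω‖ ≤ K :=
          (norm_sub_clipEntries_le fun k l => (abs_apply_le_matSpectralNorm _ k l).trans
            (hω.dropCol i).mid).trans (hKω i)
        have hK0 : 0 ≤ K := (norm_nonneg _).trans hCK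
        have hs0 : 0 ≤ ε⁻¹ * (√n * κ) * s := (abs_nonneg _).trans (hlt (some i))
        refine (abs_inner_resolventQ_le hn hε hκD hω i (hCdiag i ω) (hCn i ω) hCK (hlt none)
          (b := ε⁻¹ * (√n * κ) * s) fun j => hlt (some j)).trans ?_
        simp only [hRdef, Option.elim]
        calc ε⁻¹ * (ε⁻¹ * U * s + K * (ε⁻¹ * (√n * κ) * s) * (κ * ε⁻¹ * ‖u‖) / √n)
            ≤ ε⁻¹ * (ε⁻¹ * U * s + K * (ε⁻¹ * (√n * κ) * s) * (κ * ε⁻¹ * U) / √n) := by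
              gcongr
          _ = _ := by field_simp
    _ ≤ ∑ x : Fin n × Option (Fin n),
        μ.real {ω | R x.2 * s ≤ |inner ℝ (W x.1 x.2 ω) (colVec (Y ω) x.1)|} :=
        measureReal_iUnion_fintype_le _
    _ ≤ ∑ _x : Fin n × Option (Fin n), η := Finset.sum_le_sum fun x _ => hevent x.1 x.2
    _ = n * (n + 1) * η := by simp
    _ ≤ 2 * n ^ 2 * η := by
        have : (n : ℝ) * (n + 1) ≤ 2 * n ^ 2 := by nlinarith
        gcongr

end LeaveOneOut

/-! ### Concentration of `Q u` -/

/-- Testing a column of the third component against a vector `w` with `‖w‖ ≤ 1` is a `1`-Lipschitz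
observation of the triple. -/
theorem lipschitzWith_inner_colVec {p n : ℕ} (i : Fin n) {w : EuclideanSpace ℝ (Fin p)}
    (hw : ‖w‖ ≤ 1) :
    LipschitzWith 1 fun z : Matrix (Fin p) (Fin n) ℝ × Matrix (Fin n) (Fin n) ℝ ×
      Matrix (Fin p) (Fin n) ℝ => inner ℝ w (colVec z.2.2 i) := by
  refine LipschitzWith.of_dist_le_mul fun z z' => ?_
  rw [NNReal.coe_one, one_mul, Real.dist_eq, dist_eq_norm, ← inner_sub_right, ← colVec_sub]
  calc |inner ℝ w (colVec (z.2.2 - z'.2.2) i)|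
      ≤ ‖w‖ * ‖colVec (z.2.2 - z'.2.2) i‖ := abs_real_inner_le_norm _ _
    _ ≤ 1 * ‖z.2.2 - z'.2.2‖ := by
        gcongr
        exact (norm_colVec_le _ i).trans (matSpectralNorm_le_frobenius _)
    _ ≤ ‖z - z'‖ := by
        rw [one_mul]
        exact (norm_snd_le (z - z').2).trans (norm_snd_le (z - z'))

theorem mainTheorem10 {Θ : Type*} {Ω : Θ → Type*} [∀ θ, MeasurableSpace (Ω θ)]
    (P : ∀ θ, Measure (Ω θ)) [∀ θ, IsProbabilityMeasure (P θ)]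
    (p n : Θ → ℕ) (hn : ∀ θ, 2 ≤ n θ)
    (X Y : ∀ θ, Ω θ → Matrix (Fin (p θ)) (Fin (n θ)) ℝ)
    (D : ∀ θ, Ω θ → Matrix (Fin (n θ)) (Fin (n θ)) ℝ)
    (hXm : ∀ θ, Measurable (X θ)) (hYm : ∀ θ, Measurable (Y θ)) (hDm : ∀ θ, Measurable (D θ))
    (hDdiag : ∀ θ ω, (D θ ω).IsDiag)
    -- the regime `p ≤ O(n)`
    (hpn : LeO (fun θ => (p θ : ℝ)) (fun θ => (n θ : ℝ)))
    -- `(X, D, Y) ∝ 𝓔₂`, for the maximum of the three Frobenius norms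
    (hconc : LipschitzConcentrated P (fun θ ω => (X θ ω, D θ ω, Y θ ω)) 2 (fun _ => 1))
    -- the couples `(x_i, y_i)` are independent
    (hindep : ∀ θ, iIndepFun (fun i ω => (colVec (X θ ω) i, colVec (Y θ ω) i)) (P θ))
    -- `O(1) ≤ sup_i ‖E[x_i]‖, sup_i ‖E[y_i]‖ ≤ O(1)`
    (hEXlow : GeO (fun θ => ⨆ i, ‖∫ ω, colVec (X θ ω) i ∂(P θ)‖) (fun _ => 1))
    (hEYlow : GeO (fun θ => ⨆ i, ‖∫ ω, colVec (Y θ ω) i ∂(P θ)‖) (fun _ => 1))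
    (hEXup : LeO (fun θ => ⨆ i, ‖∫ ω, colVec (X θ ω) i ∂(P θ)‖) (fun _ => 1))
    (hEYup : LeO (fun θ => ⨆ i, ‖∫ ω, colVec (Y θ ω) i ∂(P θ)‖) (fun _ => 1))
    -- the diagonal matrices `D^{(i)}`
    (hDi : ∃ Di : ∀ θ, Fin (n θ) → Ω θ → Matrix (Fin (n θ)) (Fin (n θ)) ℝ,
      (∀ θ i, Measurable (Di θ i)) ∧ (∀ θ i ω, (Di θ i ω).IsDiag) ∧
      (∀ θ i, IndepFun (fun ω => (Di θ i ω, dropCol (X θ ω) i, dropCol (Y θ ω) i))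
        (fun ω => (colVec (X θ ω) i, colVec (Y θ ω) i)) (P θ)) ∧
      ∃ K : ℝ, ∀ θ, ∀ᵐ ω ∂(P θ), ∀ i, ‖dropCol (D θ ω) i - dropCol (Di θ i ω) i‖ ≤ K)
    -- the constants `κ, κ_D ≤ O(1)` and `ε ≥ O(1)`
    (κ κD ε : Θ → ℝ) (hκpos : ∀ θ, 0 < κ θ) (hκDpos : ∀ θ, 0 < κD θ)
    (hκ : LeO κ (fun _ => 1)) (hκD : LeO κD (fun _ => 1)) (hε : GeO ε (fun _ => 1))
    (hX : ∀ θ, ∀ᵐ ω ∂(P θ), matSpectralNorm (X θ ω) ≤ √(n θ) * κ θ)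
    (hY : ∀ θ, ∀ᵐ ω ∂(P θ), matSpectralNorm (Y θ ω) ≤ √(n θ) * κ θ)
    (hD : ∀ θ, ∀ᵐ ω ∂(P θ), matSpectralNorm (D θ ω) ≤ κD θ)
    (hκε : ∀ θ, κ θ ^ 2 * κD θ ≤ 1 - ε θ)
    -- the deterministic vectors `u` with `‖u‖ ≤ O(1)`
    (u : ∀ θ, EuclideanSpace ℝ (Fin (p θ))) (hu : LeO (fun θ => ‖u θ‖) (fun _ => 1)) :
    (∀ θ, ∀ᵐ ω ∂(P θ), IsUnit (resolventDenom (X θ ω) (D θ ω) (Y θ ω))) ∧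
    LipschitzConcentrated P
      (fun θ ω => Matrix.toEuclideanLin (resolventQ (X θ ω) (D θ ω) (Y θ ω)) (u θ))
      1 (fun θ => √(Real.log (n θ) / n θ)) := by
  obtain ⟨Di, hDim, hDid, hind, K, hK⟩ := hDi
  obtain ⟨C, c, hC, hc, hconc⟩ := hconc
  obtain ⟨m, hm, hEYup⟩ := hEYup
  obtain ⟨k, hk, hκ⟩ := hκ
  obtain ⟨d, hd, hκD⟩ := hκD
  obtain ⟨e, he, hε⟩ := hε
  obtain ⟨U, hU, hu⟩ := hu
  simp only [mul_one] at hEYup hκ hκD hε hu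
  have hn0 : ∀ θ, 0 < n θ := fun θ => lt_of_lt_of_le two_pos (hn θ)
  have hκe : ∀ θ, κ θ ^ 2 * κD θ ≤ 1 - e := fun θ => (hκε θ).trans (by linarith [hε θ])
  have hadm : ∀ θ, ∀ᵐ ω ∂(P θ), Admissible (κ θ) (κD θ) (X θ ω) (D θ ω) (Y θ ω) := by
    intro θ
    filter_upwards [hX θ, hY θ, hD θ] with ω h1 h2 h3 using ⟨h1, h2, hDdiag θ ω, h3⟩
  refine ⟨fun θ => ?_, ?_⟩
  · filter_upwards [hadm θ] with ω hω using isUnit_resolventDenom (hn0 θ) he (hκe θ) hω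
  have hconc' : ∀ θ, ∀ f : Matrix (Fin (p θ)) (Fin (n θ)) ℝ × Matrix (Fin (n θ)) (Fin (n θ)) ℝ ×
      Matrix (Fin (p θ)) (Fin (n θ)) ℝ → ℝ, LipschitzWith 1 f → ∀ t : ℝ, 0 < t →
      ((P θ).prod (P θ)).real {ω | t ≤ |f (X θ ω.1, D θ ω.1, Y θ ω.1) -
        f (X θ ω.2, D θ ω.2, Y θ ω.2)|} ≤ C * Real.exp (-(t / c) ^ 2) := by
    intro θ f hf t ht
    have := hconc θ f hf t ht
    rwa [mul_one, Real.rpow_two] at this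
  set T := 2 * (∫ r in Set.Ioi (0 : ℝ), C * Real.exp (-(r / c) ^ 2)) + 1 + m with hT
  have hT0 : 0 < T := by
    have : 0 ≤ ∫ r in Set.Ioi (0 : ℝ), C * Real.exp (-(r / c) ^ 2) :=
      integral_nonneg fun r => by positivity
    linarith
  have hsub : ∀ θ i (w : EuclideanSpace ℝ (Fin (p θ))), ‖w‖ ≤ 1 → ∀ t : ℝ, 0 < t →
      (P θ).real {ω | t + T ≤ |inner ℝ w (colVec (Y θ ω) i)|} ≤
        2 * C * Real.exp (-(t / c) ^ 2) := by
    intro θ i w hw t ht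
    have hint : Integrable (fun ω => colVec (Y θ ω) i) (P θ) := by
      refine Integrable.of_bound ((measurable_colVec i).comp (hYm θ)).aestronglyMeasurable
        (√(n θ) * κ θ) ?_
      filter_upwards [hY θ] with ω hω using (norm_colVec_le _ i).trans hω
    refine measureReal_abs_ge_le_of_symmetrized (hint.const_inner w) hC hc
      (fun t ht => hconc' θ _ (lipschitzWith_inner_colVec i hw) t ht) ?_ ht
    rw [integral_inner hint]
    calc |inner ℝ w (∫ ω, colVec (Y θ ω) i ∂(P θ))|
        ≤ ‖w‖ * ‖∫ ω, colVec (Y θ ω) i ∂(P θ)‖ := abs_real_inner_le_norm _ _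
      _ ≤ 1 * ‖∫ ω, colVec (Y θ ω) i ∂(P θ)‖ := by gcongr
      _ ≤ m := by
        rw [one_mul]
        exact (le_ciSup (f := fun i => ‖∫ ω, colVec (Y θ ω) i ∂(P θ)‖)
          (Set.finite_range _).bddAbove i).trans (hEYup θ)
  -- uniform constants: `sup_i |y_iᵀ Q u| ≤ B s` on the good event, where `Q u` then has the
  -- Lipschitz constant `b (1 + t) / √n`, for `s = t + T`
  set B := e⁻¹ * (e⁻¹ * U + |K| * (k * e⁻¹) ^ 2 * U) with hB
  have hB0 : 0 < B := by positivity
  set b := e⁻¹ * k * (2 * d * e⁻¹ * U + B * (T + 1)) with hb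
  have hb0 : 0 < b := by positivity
  refine ⟨4 * (2 * C) + C + Real.exp ((4 * c ^ 2 + 1) / (4 * c ^ 2 + 9 * (b * c) ^ 2)),
    4 * c ^ 2 + 9 * (b * c) ^ 2, by positivity, by positivity, fun θ f hf r hr => ?_⟩
  rw [Real.rpow_one]
  refine le_exp_of_forall_truncation (by positivity) hc hC (by positivity) (hn θ) hr
    measureReal_le_one fun t ht => ?_
  have hnpos : (0 : ℝ) < n θ := by exact_mod_cast hn0 θ
  have hrt : (0 : ℝ) < √(n θ) := Real.sqrt_pos.2 hnpos
  set S : Set (Matrix (Fin (p θ)) (Fin (n θ)) ℝ × Matrix (Fin (n θ)) (Fin (n θ)) ℝ ×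
      Matrix (Fin (p θ)) (Fin (n θ)) ℝ) := {z | Admissible (κ θ) (κD θ) z.1 z.2.1 z.2.2 ∧
    ∀ i, |inner ℝ (colVec z.2.2 i) (toEuclideanLin (resolventQ z.1 z.2.1 z.2.2) (u θ))| ≤
      B * (t + T)} with hS
  have hbad : (P θ).real {ω | (X θ ω, D θ ω, Y θ ω) ∉ S} ≤
      2 * (n θ) ^ 2 * (2 * C * Real.exp (-(t / c) ^ 2)) := by
    have hK' : ∀ᵐ ω ∂(P θ), ∀ i, ‖dropCol (D θ ω) i - dropCol (Di θ i ω) i‖ ≤ |K| := by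
      filter_upwards [hK θ] with ω hω i using (hω i).trans (le_abs_self K)
    refine le_trans (measureReal_mono ?_)
      (measureReal_sup_inner_resolventQ_le (hn0 θ) (hXm θ) (hYm θ) (hDim θ) (hDid θ) (hind θ)
        hK' (hκpos θ) (hκDpos θ).le he (hκe θ) (hadm θ)
        (fun i w hw => hsub θ i w hw t ht) hU (hu θ))
    intro ω hω hgood
    refine hω ⟨hgood.1, fun i => (hgood.2 i).trans ?_⟩
    have := hκ θ
    have := (hκpos θ).le
    rw [hB]
    gcongr
  have hLip : ∀ z ∈ S, ∀ z' ∈ S,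
      |f (toEuclideanLin (resolventQ z.1 z.2.1 z.2.2) (u θ)) -
        f (toEuclideanLin (resolventQ z'.1 z'.2.1 z'.2.2) (u θ))| ≤
      b * (1 + t) / √(n θ) * ‖z - z'‖ := by
    intro z hz z' hz'
    have h1 := hf.dist_le_mul (toEuclideanLin (resolventQ z.1 z.2.1 z.2.2) (u θ))
      (toEuclideanLin (resolventQ z'.1 z'.2.1 z'.2.2) (u θ))
    rw [NNReal.coe_one, one_mul, Real.dist_eq, dist_eq_norm] at h1
    refine h1.trans ((norm_resolventQ_sub_le (hn0 θ) he (hκe θ) hz.1 hz'.1 (by positivity)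
      hz'.2).trans ?_)
    have h2 : e⁻¹ * κ θ * (2 * κD θ * e⁻¹ * ‖u θ‖ + B * (t + T)) ≤ b * (1 + t) := by
      have hκ' := hκ θ
      have hκ0 := (hκpos θ).le
      have hκD' := hκD θ
      have hκD0 := (hκDpos θ).le
      have hu' := hu θ
      calc e⁻¹ * κ θ * (2 * κD θ * e⁻¹ * ‖u θ‖ + B * (t + T))
          ≤ e⁻¹ * k * (2 * d * e⁻¹ * U + B * (t + T)) := by gcongr
        _ ≤ e⁻¹ * k * ((2 * d * e⁻¹ * U + B * (T + 1)) * (1 + t)) := by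
            gcongr
            have h3 : 0 ≤ 2 * d * e⁻¹ * U * t := by positivity
            have h4 : 0 ≤ B * T * t := by positivity
            nlinarith
        _ = b * (1 + t) := by rw [hb]; ring
    gcongr
  have hfin := concentration_of_lipschitz_on (μ := P θ)
    (Z := fun ω => (X θ ω, D θ ω, Y θ ω)) (hconc' θ)
    (G := fun z => f (toEuclideanLin (resolventQ z.1 z.2.1 z.2.2) (u θ)))
    (L := b * (1 + t) / √(n θ)) (by positivity) hLip hr
  refine hfin.trans (add_le_add ?_ (le_of_eq ?_))
  · calc 2 * (P θ).real {ω | (X θ ω, D θ ω, Y θ ω) ∉ S}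
        ≤ 2 * (2 * (n θ) ^ 2 * (2 * C * Real.exp (-(t / c) ^ 2))) := by gcongr
      _ = _ := by ring
  · congr 4
    field_simp
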